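/- For $n\in\mathbb N$ and $S\subseteq[n]$ let $\chi_S(\vec z)=\prod_{i\in S}z_i$ on $\{-1,+1\}^n$. Given couplings $(c_S)_{S\subseteq[n]}$ and a cutoff $k_{\max}$, let $f=\sum_{S}c_S\chi_S$, let $f_{\le k_{\max}}=\sum_{|S|\le k_{\max}}c_S\chi_S$ be its truncation, $\eta=f-f_{\le k_{\max}}$ the truncation residual, $P_k=\sum_{|S|=k}c_S^2$ and $P_{>k_{\max}}=\sum_{k>k_{\max}}P_k$. Theorem (Pointwise Gaussian limit for the truncation residual). Consider a sequence, indexed by $m\in\mathbb N$, of dimensions $n$, cutoffs $k_{\max}$ and real random couplings $(c_S)_{S\subseteq[n]}$ (all depending on $m$; the couplings for different $m$ may live on different probability spaces). Suppose that, for each $m$, the omitted couplings $\{c_S:|S|>k_{\max}\}$ are independent with $\mathbb E[c_S]=0$, $\mathbb E[c_S^2]=\pi_S$ and $\mathbb E[c_S^4]\le C\pi_S^2$, where the constant $C$ does not depend on $S$ or $m$; nothing is assumed about the kept couplings. Suppose that $\mathbb E[P_{>k_{\max}}]>0$ for every $m$ and that $$\frac{\max_{|S|>k_{\max}}\pi_S}{\mathbb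 E[P_{>k_{\max}}]}\longrightarrow 0\qquad(m\to\infty),$$ and fix, for each $m$, a deterministic $\vec z\in\{-1,+1\}^n$. Then: 1. For every $m$, $\eta(\vec z)=\sum_{|S|>k_{\max}}c_S\chi_S(\vec z)$ and $\mathbb E[P_{>k_{\max}}]=\sum_{|S|>k_{\max}}\pi_S$. For every configuration $\vec w\in\{-1,+1\}^n$, $\eta(\vec w)$ is square-integrable with $\operatorname{Var}[\eta(\vec w)]=\mathbb E[P_{>k_{\max}}]$, so the variance does not depend on the configuration. 2. $\eta(\vec z)$ is asymptotically $\mathcal N(0,\mathbb E[P_{>k_{\max}}])$, in the sense that $\eta(\vec z)/\sqrt{\mathbb E[P_{>k_{\max}}]}\xrightarrow{d}\mathcal N(0,1)$ as $m\to\infty$. Moreover, if $\mathbb E[P_{>k_{\max}}]\to v$ for some $v\in[0,\infty)$ (in particular if it is constant in $m$), then $\eta(\vec z)\xrightarrow{d}\mathcal N(0,v)$. -/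

import Mathlib

open MeasureTheory ProbabilityTheory Filter
open scoped Topology NNReal

namespace TBE

/-- The Walsh function `χ_S(z) = ∏_{i ∈ S} z_i` on the Ising hypercube `{-1,+1}^n`;
a spin is an element of `ℤˣ = {1, -1}`. -/
def walsh {n : ℕ} (S : Finset (Fin n)) (z : Fin n → ℤˣ) : ℝ :=
  ∏ i ∈ S, ((z i : ℤ) : ℝ)

/-- The Ising HUBO with couplings `c`. -/
def hubo {n : ℕ} (c : Finset (Fin n) → ℝ) (z : Fin n → ℤˣ) : ℝ :=
  ∑ S : Finset (Fin n), c S * walsh S z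

/-- The truncated encoding at cutoff `kmax`: monomials of degree exceeding `kmax` are dropped. -/
def truncated {n : ℕ} (kmax : ℕ) (c : Finset (Fin n) → ℝ) (z : Fin n → ℤˣ) : ℝ :=
  ∑ S : Finset (Fin n) with S.card ≤ kmax, c S * walsh S z

/-- The truncation residual `η = f - f_{≤ kmax}`. -/
def residual {n : ℕ} (kmax : ℕ) (c : Finset (Fin n) → ℝ) (z : Fin n → ℤˣ) : ℝ :=
  hubo c z - truncated kmax c z

/-- The degree-`k` spectral power `P_k = ∑_{|S| = k} c_S²`. -/
def spectralPower {n : ℕ} (c : Finset (Fin n) → ℝ) (k : ℕ) : ℝ :=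
  ∑ S : Finset (Fin n) with S.card = k, c S ^ 2

/-- The omitted spectral power `P_{> kmax} = ∑_{k > kmax} P_k` (degrees never exceed `n`). -/
def tailPower {n : ℕ} (kmax : ℕ) (c : Finset (Fin n) → ℝ) : ℝ :=
  ∑ k ∈ Finset.Ioc kmax n, spectralPower c k

/-- The expected omitted spectral power `𝔼[P_{> kmax}]` of random couplings `c`. -/
noncomputable def expectedTailPower {n : ℕ} {Ω : Type*} [MeasurableSpace Ω] (P : Measure Ω)
    (kmax : ℕ) (c : Finset (Fin n) → Ω → ℝ) : ℝ :=
  ∫ ω, tailPower kmax (fun S => c S ω) ∂P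

/-- The largest variance `max_{|S| > kmax} π_S` of an omitted coupling. -/
noncomputable def maxOmittedVariance {n : ℕ} (kmax : ℕ) (π : Finset (Fin n) → ℝ) : ℝ :=
  ⨆ S : {S : Finset (Fin n) // kmax < S.card}, π S

/-- The random-coupling ensemble with variance profile `π` and fourth-moment constant `C`: the
omitted couplings are independent, have mean zero, variances `π_S`, and fourth moments at most
`C π_S²`. Nothing is assumed about the kept couplings. -/
structure RandomCouplingEnsemble {n : ℕ} {Ω : Type*} [MeasurableSpace Ω] (P : Measure Ω)
    (kmax : ℕ) (π : Finset (Fin n) → ℝ) (C : ℝ) (c : Finset (Fin n) → Ω → ℝ) : Prop where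
  indep : iIndepFun (fun (S : {S : Finset (Fin n) // kmax < S.card}) => c S) P
  memLp : ∀ S : Finset (Fin n), kmax < S.card → MemLp (c S) 4 P
  mean : ∀ S : Finset (Fin n), kmax < S.card → ∫ ω, c S ω ∂P = 0
  second : ∀ S : Finset (Fin n), kmax < S.card → ∫ ω, c S ω ^ 2 ∂P = π S
  fourth : ∀ S : Finset (Fin n), kmax < S.card → ∫ ω, c S ω ^ 4 ∂P ≤ C * π S ^ 2

end TBE

/-!
The residual at a fixed configuration is a sum of independent centred variables `c_S χ_S(z)`, and
the signs `χ_S(z) = ±1` change none of the even moments. The claim is therefore a Lyapunov central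
limit theorem for triangular arrays, proved here with characteristic functions.

If `X` is centred with variance `s ≤ M` and `𝔼[X⁴] ≤ C s²`, a second-order Taylor expansion gives
`|φ_X(t) - exp (-s t² / 2)| ≤ s · O(√M + M)` for fixed `t` and `C` (`norm_charFun_sub_exp_le`). By
independence the characteristic function of a sum is a product, and products in the closed unit
disc are compared factor by factor, so for the whole sum the error is at most `V · O(√M + M)` with
`V = ∑ s` (`norm_charFun_sum_sub_exp_le`). When `V → v` and `M → 0` this tends to zero, and Lévy's
continuity theorem gives convergence to the centred Gaussian of variance `v`
(`tendstoInDistribution_sum_gaussianReal`). Both limits of the statement are instances: dividing by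
the standard deviation makes `V = 1` and `M` the ratio assumed to vanish, while without rescaling
`M` is that ratio times the convergent quantity `V`.
-/

/-! ### Elementary estimates -/

/-- Telescoping bound for products in the closed unit ball. -/
lemma norm_prod_sub_prod_le_sum {ι : Type*} (s : Finset ι) (a b : ι → ℂ)
    (ha : ∀ i ∈ s, ‖a i‖ ≤ 1) (hb : ∀ i ∈ s, ‖b i‖ ≤ 1) :
    ‖∏ i ∈ s, a i - ∏ i ∈ s, b i‖ ≤ ∑ i ∈ s, ‖a i - b i‖ := by
  classical
  induction s using Finset.induction with
  | empty => simp
  | insert i s hi ih =>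
    rw [Finset.prod_insert hi, Finset.prod_insert hi, Finset.sum_insert hi]
    have hs : ‖∏ j ∈ s, a j‖ ≤ 1 := by
      rw [norm_prod]
      exact Finset.prod_le_one (fun _ _ => norm_nonneg _)
        fun j hj => ha j (Finset.mem_insert_of_mem hj)
    have ih' := ih (fun j hj => ha j (Finset.mem_insert_of_mem hj))
      (fun j hj => hb j (Finset.mem_insert_of_mem hj))
    have hbi := hb i (Finset.mem_insert_self i s)
    calc ‖a i * ∏ j ∈ s, a j - b i * ∏ j ∈ s, b j‖
        = ‖(a i - b i) * ∏ j ∈ s, a j + b i * (∏ j ∈ s, a j - ∏ j ∈ s, b j)‖ := by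
          congr 1; ring
      _ ≤ ‖a i - b i‖ * ‖∏ j ∈ s, a j‖ + ‖b i‖ * ‖∏ j ∈ s, a j - ∏ j ∈ s, b j‖ := by
          simpa only [norm_mul] using norm_add_le ((a i - b i) * ∏ j ∈ s, a j)
            (b i * (∏ j ∈ s, a j - ∏ j ∈ s, b j))
      _ ≤ ‖a i - b i‖ * 1 + 1 * ∑ j ∈ s, ‖a j - b j‖ := by gcongr
      _ = _ := by ring

lemma norm_exp_mul_I_sub_taylor_two_le (x : ℝ) :
    ‖Complex.exp (x * Complex.I) - (1 + x * Complex.I - x ^ 2 / 2)‖ ≤ 4 * |x| ^ 3 := by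
  rcases le_total |x| 1 with hx | hx
  · have h := Complex.norm_exp_sub_sum_le_norm_mul_exp (x * Complex.I) 3
    have hsum : ∑ k ∈ Finset.range 3, ((x : ℂ) * Complex.I) ^ k / (k.factorial : ℂ) =
        1 + x * Complex.I - x ^ 2 / 2 := by
      simp [Finset.sum_range_succ, mul_pow]
      ring
    have hn : ‖(x : ℂ) * Complex.I‖ = |x| := by simp
    rw [hsum, hn] at h
    have he : Real.exp |x| ≤ 4 :=
      (Real.exp_le_exp.2 hx).trans (Real.exp_one_lt_d9.le.trans (by norm_num))
    nlinarith [pow_nonneg (abs_nonneg x) 3]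
  · have h1 : ‖Complex.exp (x * Complex.I)‖ = 1 := Complex.norm_exp_ofReal_mul_I x
    have h2 : ‖(1 + x * Complex.I - x ^ 2 / 2 : ℂ)‖ ≤ 1 + |x| + |x| ^ 2 / 2 := by
      refine (norm_sub_le _ _).trans (add_le_add ((norm_add_le _ _).trans ?_) ?_) <;> simp
    have h3 := norm_sub_le (Complex.exp (x * Complex.I)) (1 + x * Complex.I - x ^ 2 / 2)
    have h4 : |x| ≤ |x| ^ 3 := le_self_pow₀ hx (by norm_num)
    have h5 : |x| ^ 2 ≤ |x| ^ 3 := pow_le_pow_right₀ hx (by norm_num)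
    linarith

lemma abs_exp_neg_sub_one_sub_le_sq {u : ℝ} (hu : 0 ≤ u) :
    |Real.exp (-u) - (1 - u)| ≤ u ^ 2 := by
  rcases le_total u 1 with h | h
  · have := Real.abs_exp_sub_one_sub_id_le (x := -u) (by rwa [abs_neg, abs_of_nonneg hu])
    rw [neg_sq] at this
    convert this using 2
    ring
  · have h1 : Real.exp (-u) ≤ 1 := Real.exp_le_one_iff.2 (by linarith)
    have h2 := Real.add_one_le_exp (-u)
    rw [abs_of_nonneg (by linarith)]
    nlinarith

/-- The bound `|x|³ ≤ (δ x² + x⁴ / δ) / 2` replaces the Cauchy–Schwarz estimate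
`𝔼|X|³ ≤ (𝔼[X²] 𝔼[X⁴])^{1/2}` for third absolute moments. With `δ = √M`, where `M` bounds the
variances, both terms integrate to at most a constant times `√M 𝔼[X²]`. -/
lemma abs_pow_three_le {δ : ℝ} (hδ : 0 < δ) (x : ℝ) :
    |x| ^ 3 ≤ (δ * x ^ 2 + x ^ 4 / δ) / 2 := by
  have h : (δ * x ^ 2 + x ^ 4 / δ) / 2 - |x| ^ 3 = x ^ 2 * (δ - |x|) ^ 2 / (2 * δ) := by
    have h2 : x ^ 2 = |x| ^ 2 := (sq_abs x).symm
    have h4 : x ^ 4 = |x| ^ 4 := by rw [← abs_pow, abs_of_nonneg (by positivity)]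
    rw [h4, h2]
    field_simp
    ring
  have : 0 ≤ x ^ 2 * (δ - |x|) ^ 2 / (2 * δ) := by positivity
  linarith

/-! ### Lyapunov's theorem for triangular arrays -/

section Lyapunov

variable {Ω : Type*} [MeasurableSpace Ω] {P : Measure Ω}

lemma charFun_map_eq_integral {X : Ω → ℝ} (hX : AEMeasurable X P) (t : ℝ) :
    charFun (P.map X) t = ∫ ω, Complex.exp (((t * X ω : ℝ) : ℂ) * Complex.I) ∂P := by
  rw [charFun_apply_real, integral_map hX (by fun_prop)]
  simp

variable [IsProbabilityMeasure P]

/-- A centred variable with variance `s ≤ M` and fourth moment at most `C s²` has nearly the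
characteristic function of a Gaussian; the error is `s` times a quantity that vanishes with `M`,
so that errors add up over independent summands. -/
lemma norm_charFun_sub_exp_le {X : Ω → ℝ} {s C M : ℝ} (hX : MemLp X 4 P)
    (h1 : ∫ ω, X ω ∂P = 0) (h2 : ∫ ω, X ω ^ 2 ∂P = s) (h4 : ∫ ω, X ω ^ 4 ∂P ≤ C * s ^ 2)
    (hM : 0 < M) (hsM : s ≤ M) (t : ℝ) :
    ‖charFun (P.map X) t - Complex.exp (-(s * t ^ 2 / 2 : ℝ))‖ ≤
      s * (2 * |t| ^ 3 * (1 + |C|) * √M + t ^ 4 * M / 4) := by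
  have hs : 0 ≤ s := h2 ▸ integral_nonneg fun ω => sq_nonneg _
  have hXm : AEMeasurable X P := hX.aestronglyMeasurable.aemeasurable
  have i4 : Integrable (fun ω => X ω ^ 4) P := by
    have := hX.integrable_norm_pow (p := 4) (by norm_num)
    refine this.congr (.of_forall fun ω => ?_)
    simp only [Real.norm_eq_abs]
    rw [← abs_pow, abs_of_nonneg (by positivity)]
  have i2 : Integrable (fun ω => X ω ^ 2) P := (hX.mono_exponent (by norm_num)).integrable_sq
  have i1 : Integrable X P := hX.integrable (by norm_num)
  have iexp : Integrable (fun ω => Complex.exp (((t * X ω : ℝ) : ℂ) * Complex.I)) P := by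
    refine Integrable.of_bound (by fun_prop) 1 (.of_forall fun ω => ?_)
    rw [Complex.norm_exp_ofReal_mul_I]
  have hδ : 0 < √M := Real.sqrt_pos.2 hM
  have e : (fun ω => (1 + ((t * X ω : ℝ) : ℂ) * Complex.I - ((t * X ω : ℝ) : ℂ) ^ 2 / 2)) =
      fun ω => (1 + (X ω : ℂ) * (t * Complex.I) - ((X ω ^ 2 : ℝ) : ℂ) * (t ^ 2 / 2)) := by
    funext ω; push_cast; ring
  have iT : Integrable (fun ω => (1 + ((t * X ω : ℝ) : ℂ) * Complex.I
      - ((t * X ω : ℝ) : ℂ) ^ 2 / 2)) P := by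
    rw [e]
    exact ((integrable_const _).add (i1.ofReal.mul_const _)).sub (i2.ofReal.mul_const _)
  have eT : ∫ ω, (1 + ((t * X ω : ℝ) : ℂ) * Complex.I - ((t * X ω : ℝ) : ℂ) ^ 2 / 2) ∂P =
      ((1 - s * t ^ 2 / 2 : ℝ) : ℂ) := by
    rw [e, integral_sub ((integrable_const _).add (i1.ofReal.mul_const _)) (i2.ofReal.mul_const _),
      integral_add (integrable_const _) (i1.ofReal.mul_const _), integral_mul_const,
      integral_mul_const, integral_complex_ofReal, integral_complex_ofReal, h1, h2]
    simp
    ring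
  have hA : ‖charFun (P.map X) t - ((1 - s * t ^ 2 / 2 : ℝ) : ℂ)‖ ≤
      s * (2 * |t| ^ 3 * (1 + |C|) * √M) := by
    rw [charFun_map_eq_integral hXm, ← eT, ← integral_sub iexp iT]
    calc _ ≤ ∫ ω, 2 * |t| ^ 3 * (√M * X ω ^ 2 + X ω ^ 4 / √M) ∂P := by
          refine norm_integral_le_of_norm_le (((i2.const_mul _).add (i4.div_const _)).const_mul _)
            (.of_forall fun ω => (norm_exp_mul_I_sub_taylor_two_le (t * X ω)).trans ?_)
          rw [abs_mul, mul_pow]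
          have := mul_le_mul_of_nonneg_left (abs_pow_three_le hδ (X ω))
            (by positivity : 0 ≤ 4 * |t| ^ 3)
          linarith
      _ = 2 * |t| ^ 3 * (√M * s + (∫ ω, X ω ^ 4 ∂P) / √M) := by
          rw [integral_const_mul, integral_add (i2.const_mul _) (i4.div_const _),
            integral_const_mul, integral_div, h2]
      _ ≤ 2 * |t| ^ 3 * (√M * s + |C| * s * √M) := by
          gcongr
          rw [div_le_iff₀ hδ, mul_assoc, Real.mul_self_sqrt hM.le]
          calc _ ≤ C * s ^ 2 := h4
            _ ≤ |C| * s ^ 2 := by gcongr; exact le_abs_self C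
            _ = |C| * s * s := by ring
            _ ≤ |C| * s * M := by gcongr
      _ = _ := by ring
  have hB : ‖((1 - s * t ^ 2 / 2 : ℝ) : ℂ) - Complex.exp (-(s * t ^ 2 / 2 : ℝ))‖ ≤
      s * (t ^ 4 * M / 4) := by
    rw [← Complex.ofReal_neg, ← Complex.ofReal_exp, ← Complex.ofReal_sub, Complex.norm_real,
      Real.norm_eq_abs, abs_sub_comm]
    refine (abs_exp_neg_sub_one_sub_le_sq (by positivity)).trans ?_
    calc (s * t ^ 2 / 2) ^ 2 = s * (t ^ 4 * s / 4) := by ring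
      _ ≤ _ := by gcongr
  calc _ ≤ _ := norm_sub_le_norm_sub_add_norm_sub _ ((1 - s * t ^ 2 / 2 : ℝ) : ℂ) _
    _ ≤ _ := add_le_add hA hB
    _ = _ := by ring

lemma norm_charFun_sum_sub_exp_le {ι : Type*} [Fintype ι] {X : ι → Ω → ℝ} {s : ι → ℝ} {C M : ℝ}
    (hind : iIndepFun X P) (hX : ∀ i, MemLp (X i) 4 P)
    (h1 : ∀ i, ∫ ω, X i ω ∂P = 0) (h2 : ∀ i, ∫ ω, X i ω ^ 2 ∂P = s i)
    (h4 : ∀ i, ∫ ω, X i ω ^ 4 ∂P ≤ C * s i ^ 2)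
    (hM : 0 < M) (hsM : ∀ i, s i ≤ M) (t : ℝ) :
    ‖charFun (P.map fun ω => ∑ i, X i ω) t - Complex.exp (-((∑ i, s i) * t ^ 2 / 2 : ℝ))‖ ≤
      (∑ i, s i) * (2 * |t| ^ 3 * (1 + |C|) * √M + t ^ 4 * M / 4) := by
  have hXm i : AEMeasurable (X i) P := (hX i).aestronglyMeasurable.aemeasurable
  have hs i : 0 ≤ s i := h2 i ▸ integral_nonneg fun ω => sq_nonneg _
  have hexp : Complex.exp (-((∑ i, s i) * t ^ 2 / 2 : ℝ)) =
      ∏ i, Complex.exp (-(s i * t ^ 2 / 2 : ℝ)) := by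
    rw [← Complex.exp_sum, Finset.sum_neg_distrib, ← Complex.ofReal_sum, ← Finset.sum_div,
      ← Finset.sum_mul]
  rw [hind.charFun_map_fun_sum_eq_prod hXm, Finset.prod_apply, hexp, Finset.sum_mul]
  refine (norm_prod_sub_prod_le_sum _ _ _ (fun i _ => ?_) fun i _ => ?_).trans
    (Finset.sum_le_sum fun i _ => norm_charFun_sub_exp_le (hX i) (h1 i) (h2 i) (h4 i) hM (hsM i) t)
  · have := Measure.isProbabilityMeasure_map (hXm i)
    exact norm_charFun_le_one t
  · rw [← Complex.ofReal_neg, Complex.norm_exp_ofReal, Real.exp_le_one_iff, neg_nonpos]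
    have := hs i
    positivity

end Lyapunov

/-- Lyapunov's central limit theorem for triangular arrays, under the fourth-moment condition
`𝔼[X⁴] ≤ C 𝔼[X²]²`. The limiting variance may be zero. -/
theorem tendstoInDistribution_sum_gaussianReal
    {Ω : ℕ → Type*} [∀ m, MeasurableSpace (Ω m)]
    {P : ∀ m, Measure (Ω m)} [∀ m, IsProbabilityMeasure (P m)]
    {ι : ℕ → Type*} [∀ m, Fintype (ι m)] {X : ∀ m, ι m → Ω m → ℝ} {s : ∀ m, ι m → ℝ}
    {C : ℝ} {M : ℕ → ℝ} {v : ℝ≥0}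
    (hind : ∀ m, iIndepFun (X m) (P m)) (hX : ∀ m i, MemLp (X m i) 4 (P m))
    (h1 : ∀ m i, ∫ ω, X m i ω ∂P m = 0) (h2 : ∀ m i, ∫ ω, X m i ω ^ 2 ∂P m = s m i)
    (h4 : ∀ m i, ∫ ω, X m i ω ^ 4 ∂P m ≤ C * s m i ^ 2)
    (hM : ∀ m, 0 < M m) (hsM : ∀ m i, s m i ≤ M m) (hM0 : Tendsto M atTop (𝓝 0))
    (hv : Tendsto (fun m => ∑ i, s m i) atTop (𝓝 (v : ℝ))) :
    TendstoInDistribution (fun m ω => ∑ i, X m i ω) atTop (id : ℝ → ℝ) P (gaussianReal 0 v) where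
  forall_aemeasurable m := Finset.aemeasurable_fun_sum _ fun i _ =>
    (hX m i).aestronglyMeasurable.aemeasurable
  tendsto := by
    refine ProbabilityMeasure.tendsto_iff_tendsto_charFun.2 fun t => ?_
    simp only [ProbabilityMeasure.coe_mk, Measure.map_id, charFun_gaussianReal]
    have hG : Tendsto (fun m => Complex.exp (-((∑ i, s m i) * t ^ 2 / 2 : ℝ))) atTop
        (𝓝 (Complex.exp (t * (0 : ℝ) * Complex.I - (v : ℝ) * t ^ 2 / 2))) := by
      have hc : Continuous fun x : ℝ => Complex.exp (-(x * t ^ 2 / 2 : ℝ)) := by fun_prop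
      have h := (hc.tendsto (v : ℝ)).comp hv
      rw [show (t : ℂ) * (0 : ℝ) * Complex.I - (v : ℝ) * t ^ 2 / 2 = -((v * t ^ 2 / 2 : ℝ) : ℂ) by
        push_cast; ring]
      exact h
    have hE : Tendsto (fun m => (∑ i, s m i) *
        (2 * |t| ^ 3 * (1 + |C|) * √(M m) + t ^ 4 * M m / 4)) atTop (𝓝 0) := by
      have hc : Continuous fun x : ℝ => 2 * |t| ^ 3 * (1 + |C|) * √x + t ^ 4 * x / 4 := by fun_prop
      simpa using hv.mul ((hc.tendsto 0).comp hM0)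
    have hD := squeeze_zero_norm (fun m => norm_charFun_sum_sub_exp_le (hind m) (hX m) (h1 m)
      (h2 m) (h4 m) (hM m) (hsM m) t) hE
    simpa using hD.add hG

/-! ### The truncation residual -/

namespace TBE

lemma walsh_sq {n : ℕ} (S : Finset (Fin n)) (z : Fin n → ℤˣ) : walsh S z ^ 2 = 1 := by
  rw [walsh, ← Finset.prod_pow]
  refine Finset.prod_eq_one fun i _ => ?_
  rcases Int.units_eq_one_or (z i) with h | h <;> simp [h]

lemma residual_eq_sum {n : ℕ} (kmax : ℕ) (c : Finset (Fin n) → ℝ) (z : Fin n → ℤˣ) :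
    residual kmax c z = ∑ S : Finset (Fin n) with kmax < S.card, c S * walsh S z := by
  rw [residual, hubo, truncated, sub_eq_iff_eq_add', ← Finset.sum_filter_add_sum_filter_not
    Finset.univ (fun S : Finset (Fin n) => S.card ≤ kmax)]
  simp only [not_le]

lemma sum_omitted_eq_sum_subtype {n : ℕ} (kmax : ℕ) (g : Finset (Fin n) → ℝ) :
    ∑ S : Finset (Fin n) with kmax < S.card, g S =
      ∑ S : {S : Finset (Fin n) // kmax < S.card}, g S :=
  Finset.sum_subtype _ (by simp) g

lemma tailPower_eq_sum {n : ℕ} (kmax : ℕ) (c : Finset (Fin n) → ℝ) :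
    tailPower kmax c = ∑ S : Finset (Fin n) with kmax < S.card, c S ^ 2 := by
  rw [tailPower, ← Finset.sum_fiberwise_of_maps_to (t := Finset.Ioc kmax n) (g := Finset.card)]
  · refine Finset.sum_congr rfl fun k hk => ?_
    rw [spectralPower, Finset.filter_filter]
    refine Finset.sum_congr (Finset.filter_congr fun S _ => ?_) fun _ _ => rfl
    rw [Finset.mem_Ioc] at hk
    omega
  · intro S hS
    simpa using ⟨(Finset.mem_filter.1 hS).2, card_finset_fin_le S⟩

lemma le_maxOmittedVariance {n : ℕ} {kmax : ℕ} (π : Finset (Fin n) → ℝ)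
    (S : {S : Finset (Fin n) // kmax < S.card}) : π S ≤ maxOmittedVariance kmax π :=
  le_ciSup (f := fun S : {S : Finset (Fin n) // kmax < S.card} => π S)
    (Set.finite_range _).bddAbove S

namespace RandomCouplingEnsemble

variable {n : ℕ} {Ω : Type*} [MeasurableSpace Ω] {P : Measure Ω} [IsProbabilityMeasure P]
  {kmax : ℕ} {π : Finset (Fin n) → ℝ} {C : ℝ} {c : Finset (Fin n) → Ω → ℝ}

lemma memLp_two (h : RandomCouplingEnsemble P kmax π C c) {S : Finset (Fin n)}
    (hS : kmax < S.card) : MemLp (c S) 2 P :=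
  (h.memLp S hS).mono_exponent (by norm_num)

lemma expectedTailPower_eq (h : RandomCouplingEnsemble P kmax π C c) :
    expectedTailPower P kmax c = ∑ S : Finset (Fin n) with kmax < S.card, π S := by
  simp only [expectedTailPower, tailPower_eq_sum]
  rw [integral_finsetSum _ fun S hS => (h.memLp_two (Finset.mem_filter.1 hS).2).integrable_sq]
  exact Finset.sum_congr rfl fun S hS => h.second S (Finset.mem_filter.1 hS).2

lemma maxOmittedVariance_pos (h : RandomCouplingEnsemble P kmax π C c)
    (hpos : 0 < expectedTailPower P kmax c) : 0 < maxOmittedVariance kmax π := by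
  rw [h.expectedTailPower_eq, sum_omitted_eq_sum_subtype] at hpos
  obtain ⟨S, -, hS⟩ := Finset.exists_lt_of_sum_lt (f := fun _ => (0 : ℝ)) (by simpa using hpos)
  exact hS.trans_le (le_maxOmittedVariance π S)

lemma memLp_residual (h : RandomCouplingEnsemble P kmax π C c) (w : Fin n → ℤˣ) :
    MemLp (fun ω => residual kmax (fun S => c S ω) w) 2 P := by
  simp only [residual_eq_sum]
  exact memLp_finsetSum _ fun S hS =>
    (h.memLp_two (Finset.mem_filter.1 hS).2).mul_const (walsh S w)

lemma variance_residual (h : RandomCouplingEnsemble P kmax π C c) (w : Fin n → ℤˣ) :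
    Var[fun ω => residual kmax (fun S => c S ω) w; P] = expectedTailPower P kmax c := by
  have e : (fun ω => residual kmax (fun S => c S ω) w) =
      ∑ S : {S : Finset (Fin n) // kmax < S.card}, fun ω => c S ω * walsh S w := by
    funext ω
    rw [residual_eq_sum, sum_omitted_eq_sum_subtype, Finset.sum_apply]
  rw [e, IndepFun.variance_sum (fun S _ => (h.memLp_two S.2).mul_const _), h.expectedTailPower_eq,
    sum_omitted_eq_sum_subtype]
  · refine Finset.sum_congr rfl fun S _ => ?_
    have hm := h.memLp_two S.2
    rw [variance_mul_const, walsh_sq, mul_one,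
      variance_of_integral_eq_zero hm.aestronglyMeasurable.aemeasurable (h.mean S S.2)]
    exact h.second S S.2
  · intro S _ T _ hST
    exact (h.indep.indepFun hST).comp (measurable_mul_const (walsh S w))
      (measurable_mul_const (walsh T w))

end RandomCouplingEnsemble

/-- Gaussian limit of the residual multiplied by a deterministic scale `a m`. The scales
`1 / √𝔼[P_{> kmax}]` and `1` give the normalized and the unnormalized limit. -/
theorem tendstoInDistribution_residual_mul
    {Ω : ℕ → Type*} [∀ m, MeasurableSpace (Ω m)]
    {P : ∀ m, Measure (Ω m)} [∀ m, IsProbabilityMeasure (P m)]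
    {n kmax : ℕ → ℕ} {π : ∀ m, Finset (Fin (n m)) → ℝ}
    {c : ∀ m, Finset (Fin (n m)) → Ω m → ℝ} {C : ℝ}
    (hens : ∀ m, RandomCouplingEnsemble (P m) (kmax m) (π m) C (c m))
    (hpos : ∀ m, 0 < expectedTailPower (P m) (kmax m) (c m))
    (z : ∀ m, Fin (n m) → ℤˣ) {a : ℕ → ℝ} (ha : ∀ m, a m ≠ 0) {v : ℝ≥0}
    (hmax : Tendsto (fun m => a m ^ 2 * maxOmittedVariance (kmax m) (π m)) atTop (𝓝 0))
    (hv : Tendsto (fun m => a m ^ 2 * expectedTailPower (P m) (kmax m) (c m)) atTop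
      (𝓝 (v : ℝ))) :
    TendstoInDistribution (fun m ω => residual (kmax m) (fun S => c m S ω) (z m) * a m)
      atTop (id : ℝ → ℝ) P (gaussianReal 0 v) := by
  have e : (fun m ω => residual (kmax m) (fun S => c m S ω) (z m) * a m) = fun m ω =>
      ∑ S : {S : Finset (Fin (n m)) // kmax m < S.card}, c m S ω * (walsh S (z m) * a m) := by
    funext m ω
    rw [residual_eq_sum, sum_omitted_eq_sum_subtype, Finset.sum_mul]
    exact Finset.sum_congr rfl fun S _ => mul_assoc _ _ _
  have hsq m (S : Finset (Fin (n m))) : (walsh S (z m) * a m) ^ 2 = a m ^ 2 := by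
    rw [mul_pow, walsh_sq, one_mul]
  rw [e]
  refine tendstoInDistribution_sum_gaussianReal (C := C)
    (ι := fun m => {S : Finset (Fin (n m)) // kmax m < S.card})
    (X := fun m S ω => c m S ω * (walsh S.1 (z m) * a m)) (s := fun m S => a m ^ 2 * π m S)
    (M := fun m => a m ^ 2 * maxOmittedVariance (kmax m) (π m))
    (fun m => (hens m).indep.comp (fun S x => x * (walsh S.1 (z m) * a m))
      fun S => measurable_mul_const _)
    (fun m S => ((hens m).memLp S S.2).mul_const _) (fun m S => ?_) (fun m S => ?_)
    (fun m S => ?_) (fun m => mul_pos (sq_pos_of_ne_zero (ha m))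
      ((hens m).maxOmittedVariance_pos (hpos m)))
    (fun m S => mul_le_mul_of_nonneg_left (le_maxOmittedVariance (π m) S) (sq_nonneg _)) hmax ?_
  · rw [integral_mul_const, (hens m).mean S S.2, zero_mul]
  · simp only [mul_pow _ (walsh _ _ * _), hsq]
    rw [integral_mul_const, (hens m).second S S.2, mul_comm]
  · have h4 : (walsh S.1 (z m) * a m) ^ 4 = (a m ^ 2) ^ 2 := by
      rw [← hsq m S.1]; ring
    simp only [mul_pow _ (walsh _ _ * _), h4]
    rw [integral_mul_const]
    calc _ ≤ C * π m S ^ 2 * (a m ^ 2) ^ 2 := by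
          gcongr; exact (hens m).fourth S S.2
      _ = _ := by ring
  · refine hv.congr fun m => ?_
    rw [(hens m).expectedTailPower_eq, sum_omitted_eq_sum_subtype, Finset.mul_sum]

end TBE

/-- Pointwise Gaussian limit for the truncation residual, for a sequence of random-coupling
ensembles sharing one fourth-moment constant `C`. The `m`-th ensemble has `n m` spins, cutoff
`kmax m`, variance profile `π m`, couplings `c m`, and configuration `z m` held fixed. -/
theorem mainTheorem8
    {Ω : ℕ → Type*} [∀ m, MeasurableSpace (Ω m)]
    (P : ∀ m, Measure (Ω m)) [∀ m, IsProbabilityMeasure (P m)]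
    (n kmax : ℕ → ℕ)
    (π : ∀ m, Finset (Fin (n m)) → ℝ)
    (c : ∀ m, Finset (Fin (n m)) → Ω m → ℝ)
    (C : ℝ)
    (hens : ∀ m, TBE.RandomCouplingEnsemble (P m) (kmax m) (π m) C (c m))
    (hpos : ∀ m, 0 < TBE.expectedTailPower (P m) (kmax m) (c m))
    (hmax : Tendsto (fun m => TBE.maxOmittedVariance (kmax m) (π m) /
      TBE.expectedTailPower (P m) (kmax m) (c m)) atTop (𝓝 0))
    (z : ∀ m, Fin (n m) → ℤˣ) :
    -- the residual is the sum of the omitted Walsh modes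
    (∀ m ω, TBE.residual (kmax m) (fun S => c m S ω) (z m) =
      ∑ S : Finset (Fin (n m)) with kmax m < S.card, c m S ω * TBE.walsh S (z m)) ∧
    -- the expected omitted power is the sum of the omitted variances
    (∀ m, TBE.expectedTailPower (P m) (kmax m) (c m) =
      ∑ S : Finset (Fin (n m)) with kmax m < S.card, π m S) ∧
    -- at every configuration the residual has variance equal to the expected omitted power
    (∀ m (w : Fin (n m) → ℤˣ),
      MemLp (fun ω => TBE.residual (kmax m) (fun S => c m S ω) w) 2 (P m) ∧
      Var[fun ω => TBE.residual (kmax m) (fun S => c m S ω) w; P m] =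
        TBE.expectedTailPower (P m) (kmax m) (c m)) ∧
    -- the residual, in units of its standard deviation, converges to the standard Gaussian
    TendstoInDistribution
      (fun m ω => TBE.residual (kmax m) (fun S => c m S ω) (z m) /
        √(TBE.expectedTailPower (P m) (kmax m) (c m)))
      atTop (id : ℝ → ℝ) P (gaussianReal 0 1) ∧
    -- and without rescaling, whenever the expected omitted power has a limit `v`
    -- (for instance when it is constant), it converges to the Gaussian of variance `v`
    (∀ v : ℝ≥0,
      Tendsto (fun m => TBE.expectedTailPower (P m) (kmax m) (c m)) atTop (𝓝 (v : ℝ)) →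
      TendstoInDistribution
        (fun m ω => TBE.residual (kmax m) (fun S => c m S ω) (z m))
        atTop (id : ℝ → ℝ) P (gaussianReal 0 v)) := by
  refine ⟨fun m ω => TBE.residual_eq_sum _ _ _, fun m => (hens m).expectedTailPower_eq,
    fun m w => ⟨(hens m).memLp_residual w, (hens m).variance_residual w⟩, ?_, fun v hv => ?_⟩
  · have hsq m : (√(TBE.expectedTailPower (P m) (kmax m) (c m)))⁻¹ ^ 2 =
        (TBE.expectedTailPower (P m) (kmax m) (c m))⁻¹ := by
      rw [inv_pow, Real.sq_sqrt (hpos m).le]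
    simp only [div_eq_mul_inv]
    refine TBE.tendstoInDistribution_residual_mul hens hpos z
      (fun m => inv_ne_zero (Real.sqrt_pos.2 (hpos m)).ne') ?_ ?_
    · refine hmax.congr fun m => ?_
      rw [hsq, div_eq_inv_mul]
    · refine tendsto_const_nhds.congr fun m => ?_
      rw [hsq, inv_mul_cancel₀ (hpos m).ne', NNReal.coe_one]
  · have h := TBE.tendstoInDistribution_residual_mul hens hpos z (a := fun _ => 1) (v := v)
      (fun _ => one_ne_zero) ?_ (by simpa using hv)
    · simpa using h
    -- the largest variance is its ratio to the expected omitted power times a convergent factor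
    · have h := hmax.mul hv
      rw [zero_mul] at h
      refine h.congr fun m => ?_
      rw [div_mul_cancel₀ _ (hpos m).ne', one_pow, one_mul]
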